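/- All graphs are finite and simple, and $\log$ denotes the logarithm to base $2$. For a graph $H$, let $\pi(H)$ be the smallest cardinality of a family $\mathcal F$ of permutations (linear orders) of $V(H)$ such that for every two disjoint edges $e,f$ of $H$ there is a permutation in $\mathcal F$ in which all vertices of one of the two edges precede all vertices of the other. Let $G^{1/2}$ be the graph obtained from $G$ by subdividing every edge of $G$ exactly once, and let $\chi(G)$ be the chromatic number of $G$. Then $$\pi(G^{1/2}) \;\le\; \log\log(\chi(G)-1) + \Bigl(\tfrac12+o(1)\Bigr)\log\log\log(\chi(G)-1) + 2,$$ where $o(1)$ is a quantity that depends only on $\chi(G)$ and tends to $0$ as $\chi(G)\to\infty$. Precisely: there is a function $\varepsilon:\mathbb N\to\mathbb R$ with $\varepsilon(n)\to 0$ as $n\to\infty$ such that every graph $G$ with $\chi=\chi(G)\ge 6$ (equivalently, for which $\log\log\log(\chi-1)$ is defined and positive) satisfies $$\pi(G^{1/2}) \le \log\log(\chi-1) + \bigl(\tfrac12+\varepsilon(\chi)\bigr)\log\log\log(\chi-1) + 2 .$$ -/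

import Mathlib

universe u

/-- For a permutation `σ` of `V` (a bijection from `V` onto an initial segment of the naturals),
`A ≺_σ B`: every element of `A` precedes every element of `B` in `σ`. -/
def Precedes {V : Type*} (σ : V ≃ Fin (Nat.card V)) (A B : Set V) : Prop :=
  ∀ a ∈ A, ∀ b ∈ B, σ a < σ b

/-- `σ` separates `A` and `B` if `A ≺_σ B` or `B ≺_σ A`. -/
def Separates {V : Type*} (σ : V ≃ Fin (Nat.card V)) (A B : Set V) : Prop :=
  Precedes σ A B ∨ Precedes σ B A

/-- A family `F` of permutations of `V` is pairwise suitable for the hypergraph with vertex set `V`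
and edge set `E` if any two disjoint edges are separated by some member of `F`. -/
def PairwiseSuitable {V : Type*} (E : Set (Set V)) (F : Finset (V ≃ Fin (Nat.card V))) : Prop :=
  ∀ e ∈ E, ∀ f ∈ E, Disjoint e f → ∃ σ ∈ F, Separates σ e f

/-- The separation dimension of the finite hypergraph with vertex set `V` and edge set `E`: the
cardinality of a smallest pairwise suitable family of permutations. -/
noncomputable def hypergraphSeparationDimension (V : Type*) [Finite V] (E : Set (Set V)) : ℕ :=
  sInf {k : ℕ | ∃ F : Finset (V ≃ Fin (Nat.card V)), F.card = k ∧ PairwiseSuitable E F}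

/-- Two disjoint sets of vertices are separated by some permutation. -/
theorem exists_separates {V : Type*} [Finite V] (A B : Set V) (h : Disjoint A B) :
    ∃ σ : V ≃ Fin (Nat.card V), Separates σ A B := by
  classical
  let g : Fin (Nat.card V) → ℕ := fun i => if (Finite.equivFin V).symm i ∈ A then 0 else 1
  refine ⟨(Finite.equivFin V).trans (Tuple.sort g).symm, Or.inl ?_⟩
  intro a ha b hb
  have hb' : b ∉ A := fun hbA => Set.disjoint_left.mp h hbA hb
  by_contra hlt
  have hm := Tuple.monotone_sort g (not_lt.mp hlt)
  simp [g, ha, hb'] at hm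

/-- The infimum in `hypergraphSeparationDimension` is attained. -/
theorem exists_pairwiseSuitable_card_eq (V : Type*) [Finite V] (E : Set (Set V)) :
    ∃ F : Finset (V ≃ Fin (Nat.card V)),
      F.card = hypergraphSeparationDimension V E ∧ PairwiseSuitable E F := by
  classical
  have := Fintype.ofFinite V
  refine Nat.sInf_mem
    (s := {k : ℕ | ∃ F : Finset (V ≃ Fin (Nat.card V)), F.card = k ∧ PairwiseSuitable E F}) ?_
  refine ⟨_, Finset.univ, rfl, fun e _ f _ hd => ?_⟩
  obtain ⟨σ, hσ⟩ := exists_separates e f hd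
  exact ⟨σ, Finset.mem_univ _, hσ⟩

/-- The separation dimension `π(G)` of a finite graph, viewed as a 2-uniform hypergraph. -/
noncomputable def separationDimension {V : Type*} [Finite V] (G : SimpleGraph V) : ℕ :=
  hypergraphSeparationDimension V ((fun e : Sym2 V => (e : Set V)) '' G.edgeSet)

/-- The fully subdivided graph `G^{1/2}`: its vertices are the vertices of `G` together with one new
vertex for every edge of `G`, and the new vertex of an edge is adjacent exactly to the two ends of
that edge. -/
def fullSubdivision {V : Type*} (G : SimpleGraph V) : SimpleGraph (V ⊕ G.edgeSet) where
  Adj x y :=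
    match x, y with
    | Sum.inl v, Sum.inr e => v ∈ (e : Sym2 V)
    | Sum.inr e, Sum.inl v => v ∈ (e : Sym2 V)
    | Sum.inl _, Sum.inl _ => False
    | Sum.inr _, Sum.inr _ => False
  symm := ⟨by
    rintro (v | e) (w | f) h <;> exact h⟩
  loopless := ⟨by
    rintro (v | e) h <;> exact h⟩

/-! Colour properly with numbers below `2 ^ N`, where `N = m.centralBinom`, and orient each edge
from lower to higher colour. Orders by colour in which each edge point follows its lower (or its
upper) end separate all pairs except a lower end `lo e` and an upper end `hi f` with `c (lo e) < c
(hi f)`. There `e` must go low and `f` high. If their top differing digits differ, an antichain of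
`N` subsets of `2 * m` layers supplies a layer that does this; if the digits agree, two orders by a
common threshold suffice. Since `log N` is about `2 * m - (log m) / 2`, the `2 * m + 4` orders give
the bound, with constants absorbed in `ε`. -/

/-- Three integers compared lexicographically. -/
abbrev lexTriple (a b c : ℤ) : ℤ ×ₗ ℤ ×ₗ ℤ := toLex (a, toLex (b, c))

theorem lexTriple_lt_iff {a b c a' b' c' : ℤ} :
    lexTriple a b c < lexTriple a' b' c' ↔
      a < a' ∨ a = a' ∧ (b < b' ∨ b = b' ∧ c < c') := by
  simp [lexTriple, Prod.Lex.lt_iff]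

/-- Sorting a finite type by a key gives a permutation compatible with the key. -/
theorem exists_equivFin_lt_of_key_lt {X α : Type*} [Finite X] [LinearOrder α] (k : X → α) :
    ∃ σ : X ≃ Fin (Nat.card X), ∀ x y, k x < k y → σ x < σ y := by
  let g : Fin (Nat.card X) → α := fun i => k ((Finite.equivFin X).symm i)
  refine ⟨(Finite.equivFin X).trans (Tuple.sort g).symm, fun x y hxy => ?_⟩
  by_contra hlt
  have hm := Tuple.monotone_sort g (not_lt.mp hlt)
  simp only [g, Function.comp_apply, Equiv.trans_apply, Equiv.apply_symm_apply,
    Equiv.symm_apply_apply] at hm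
  exact absurd hxy (not_lt.mpr hm)

/-- A family of keys that separates all disjoint edges bounds the separation dimension. -/
theorem hypergraphSeparationDimension_le_card {X ι α : Type*} [Finite X] [Fintype ι]
    [LinearOrder α] (E : Set (Set X)) (k : ι → X → α)
    (h : ∀ e ∈ E, ∀ f ∈ E, Disjoint e f →
      ∃ i, (∀ a ∈ e, ∀ b ∈ f, k i a < k i b) ∨ ∀ a ∈ f, ∀ b ∈ e, k i a < k i b) :
    hypergraphSeparationDimension X E ≤ Fintype.card ι := by
  classical
  choose σ hσ using fun i => exists_equivFin_lt_of_key_lt (k i)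
  have hF : PairwiseSuitable E (Finset.univ.image σ) := by
    intro e he f hf hd
    obtain ⟨i, hi⟩ := h e he f hf hd
    exact ⟨σ i, by simp, hi.imp (fun h a ha b hb => hσ _ _ _ (h a ha b hb))
      fun h a ha b hb => hσ _ _ _ (h a ha b hb)⟩
  unfold hypergraphSeparationDimension
  exact le_trans (Nat.sInf_le ⟨_, rfl, hF⟩) Finset.card_image_le

/-- The edges of the full subdivision are the pairs of a vertex and an edge containing it. -/
theorem exists_eq_of_mem_edgeSet_fullSubdivision {V : Type*} {G : SimpleGraph V}
    {x : Sym2 (V ⊕ G.edgeSet)} (hx : x ∈ (fullSubdivision G).edgeSet) :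
    ∃ (v : V) (e : G.edgeSet), v ∈ (e : Sym2 V) ∧ x = s(Sum.inl v, Sum.inr e) := by
  induction x using Sym2.ind with
  | _ a b =>
    rw [SimpleGraph.mem_edgeSet] at hx
    rcases a with v | e <;> rcases b with w | f
    · exact hx.elim
    · exact ⟨v, f, hx, rfl⟩
    · exact ⟨w, e, hx, Sym2.eq_swap⟩
    · exact hx.elim

/-! ### Digits, antichains and the orders -/

/-- Two distinct numbers below `2 ^ N` have a highest binary digit in which they differ. -/
theorem exists_top_differing_digit {N a b : ℕ} (hab : a < b) (hb : b < 2 ^ N) :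
    ∃ d : Fin N, a / 2 ^ (d : ℕ) < b / 2 ^ (d : ℕ) ∧
      a / 2 ^ (d : ℕ) / 2 = b / 2 ^ (d : ℕ) / 2 := by
  have hex : ∃ d, a / 2 ^ d = b / 2 ^ d :=
    ⟨N, by rw [Nat.div_eq_of_lt hb, Nat.div_eq_of_lt (hab.trans hb)]⟩
  obtain ⟨d, hd⟩ : ∃ d, Nat.find hex = d + 1 := by
    refine Nat.exists_eq_succ_of_ne_zero fun h0 => ?_
    have := Nat.find_spec hex
    rw [h0] at this
    simp at this
    omega
  have hN : Nat.find hex ≤ N :=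
    Nat.find_min' hex (by rw [Nat.div_eq_of_lt hb, Nat.div_eq_of_lt (hab.trans hb)])
  have hspec := Nat.find_spec hex
  rw [hd, pow_succ, ← Nat.div_div_eq_div_mul, ← Nat.div_div_eq_div_mul] at hspec
  have hmin := Nat.find_min hex (m := d) (by omega)
  exact ⟨⟨d, by omega⟩, lt_of_le_of_ne (Nat.div_le_div_right hab.le) hmin, hspec⟩

/-- The middle layer of the subsets of a `2 * m`-element set is an antichain. -/
theorem exists_antichain_centralBinom (m : ℕ) :
    ∃ S : Fin m.centralBinom → Finset (Fin (2 * m)),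
      ∀ d d', d ≠ d' → ∃ s ∈ S d, s ∉ S d' := by
  have hcard : (Finset.powersetCard m (Finset.univ : Finset (Fin (2 * m)))).card
      = m.centralBinom := by
    simp [Nat.centralBinom]
  let φ := (Finset.equivFinOfCardEq hcard).symm
  refine ⟨fun d => (φ d : Finset (Fin (2 * m))), fun d d' hne => ?_⟩
  have h1 := (Finset.mem_powersetCard.mp (φ d).2).2
  have h2 := (Finset.mem_powersetCard.mp (φ d').2).2
  by_contra! hsub
  exact hne (φ.injective (Subtype.ext (Finset.eq_of_subset_of_card_le hsub (by omega))))

/-- A graph with a proper colouring by `2 ^ (2m choose m)` colours has a full subdivision of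
separation dimension at most `2 * m + 4`. -/
theorem separationDimension_fullSubdivision_le {V : Type*} [Finite V] (G : SimpleGraph V)
    {m : ℕ} (c : V → ℕ) (hc : ∀ u v, G.Adj u v → c u ≠ c v)
    (hlt : ∀ v, c v < 2 ^ m.centralBinom) :
    separationDimension (fullSubdivision G) ≤ 2 * m + 4 := by
  classical
  obtain ⟨S, hS⟩ := exists_antichain_centralBinom m
  have hends : ∀ e : G.edgeSet, ∃ a b : V, (e : Sym2 V) = s(a, b) ∧ c a < c b := by
    rintro ⟨e, he⟩
    induction e using Sym2.ind with
    | _ a b =>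
      rcases lt_or_gt_of_ne (hc a b he) with h | h
      · exact ⟨a, b, rfl, h⟩
      · exact ⟨b, a, Sym2.eq_swap, h⟩
  choose lo hi heq hlohi using hends
  choose d hd hd' using fun e : G.edgeSet =>
    exists_top_differing_digit (hlohi e) (hlt (hi e))
  let vid : V → ℤ := fun v => (Finite.equivFin V v : ℕ)
  let eid : G.edgeSet → ℤ := fun e => (Finite.equivFin G.edgeSet e : ℕ)
  have hvid : ∀ v w, vid v = vid w → v = w := fun v w h => (Finite.equivFin V).injective (Fin.ext (Nat.cast_injective h))
  have heid : ∀ e f, eid e = eid f → e = f := fun e f h => (Finite.equivFin G.edgeSet).injective (Fin.ext (Nat.cast_injective h))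
  -- The upper colour with all digits below `d e` cleared: a threshold between the two end colours.
  let mid : G.edgeSet → ℕ := fun e => c (hi e) / 2 ^ (d e : ℕ) * 2 ^ (d e : ℕ)
  have hmid_hi : ∀ e, mid e ≤ c (hi e) := fun e => Nat.div_mul_le_self _ _
  have hlo_mid : ∀ e, c (lo e) < mid e := fun e =>
    (Nat.div_lt_iff_lt_mul (by positivity)).mp (hd e)
  have hmid : ∀ e f, d e = d f → c (lo e) < c (hi f) → mid e ≤ mid f := by
    intro e f hdd hlt
    have h1 := hd e
    have h2 := hd' e
    have h3 := hd f
    have h4 := hd' f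
    simp only [mid]
    rw [hdd] at h1 h2 ⊢
    have h5 := Nat.div_le_div_right (c := 2 ^ (d f : ℕ)) hlt.le
    -- The quotient of `lo e` is even and that of `hi f` odd, so the latter is at least one larger,
    -- hence at least that of `hi e`.
    exact Nat.mul_le_mul_right _ (by omega)
  clear_value mid vid eid
  let layer : Fin (2 * m) → V ⊕ G.edgeSet → ℤ ×ₗ ℤ ×ₗ ℤ := fun s =>
    Sum.elim (fun v => lexTriple (c v) 0 0)
      fun e => if s ∈ S (d e) then lexTriple (c (lo e)) 1 0 else lexTriple (c (hi e)) (-1) 0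
  let afterLo : V ⊕ G.edgeSet → ℤ ×ₗ ℤ ×ₗ ℤ :=
    Sum.elim (fun v => lexTriple (c v) (vid v) 0) fun e => lexTriple (c (lo e)) (vid (lo e)) 1
  -- Negating `vid` reverses the order inside colour classes, so ties `c (lo e) = c (hi f)` are
  -- broken both ways.
  let afterHi : V ⊕ G.edgeSet → ℤ ×ₗ ℤ ×ₗ ℤ :=
    Sum.elim (fun v => lexTriple (c v) (-vid v) 0) fun e => lexTriple (c (hi e)) (-vid (hi e)) 1
  let split : V ⊕ G.edgeSet → ℤ ×ₗ ℤ ×ₗ ℤ :=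
    Sum.elim (fun v => lexTriple (c v) 0 0) fun e => lexTriple (mid e) (-1) (eid e)
  let splitRev : V ⊕ G.edgeSet → ℤ ×ₗ ℤ ×ₗ ℤ :=
    Sum.elim (fun v => lexTriple (c v) 0 0) fun e => lexTriple (mid e) (-1) (-eid e)
  let key : Fin (2 * m) ⊕ Fin 4 → V ⊕ G.edgeSet → ℤ ×ₗ ℤ ×ₗ ℤ :=
    Sum.elim layer ![afterLo, afterHi, split, splitRev]
  let Sep : V → G.edgeSet → V → G.edgeSet → Prop := fun v e w f =>
    ∃ i, (key i (.inl v) < key i (.inl w) ∧ key i (.inl v) < key i (.inr f) ∧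
        key i (.inr e) < key i (.inl w) ∧ key i (.inr e) < key i (.inr f)) ∨
      (key i (.inl w) < key i (.inl v) ∧ key i (.inl w) < key i (.inr e) ∧
        key i (.inr f) < key i (.inl v) ∧ key i (.inr f) < key i (.inr e))
  have hlohi_sep : ∀ e f, e ≠ f → lo e ≠ hi f → Sep (lo e) e (hi f) f := by
    intro e f hef hvw
    have he := hlohi e
    have hf := hlohi f
    rcases lt_trichotomy (c (lo e)) (c (hi f)) with h | h | h
    · by_cases hdd : d e = d f
      · have h1 := hmid e f hdd h
        have h2 := hlo_mid e
        have h3 := hmid_hi f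
        -- The thresholds may coincide; then `e` must precede `f` by `eid` or by its reverse.
        have h4 : eid e ≠ eid f := fun h => hef (heid _ _ h)
        rcases lt_or_gt_of_ne h4 with h4 | h4
        · refine ⟨.inr 2, .inl ?_⟩
          simp only [key, split, Sum.elim_inl, Sum.elim_inr, Matrix.cons_val, lexTriple_lt_iff,
            true_and]
          omega
        · refine ⟨.inr 3, .inl ?_⟩
          simp only [key, splitRev, Sum.elim_inl, Sum.elim_inr, Matrix.cons_val, lexTriple_lt_iff,
            true_and]
          omega
      · obtain ⟨s, hs, hs'⟩ := hS _ _ hdd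
        refine ⟨.inl s, .inl ?_⟩
        simp only [key, layer, Sum.elim_inl, Sum.elim_inr, if_pos hs, if_neg hs', lexTriple_lt_iff]
        omega
    · have h4 : vid (lo e) ≠ vid (hi f) := fun h => hvw (hvid _ _ h)
      rcases lt_or_gt_of_ne h4 with h4 | h4
      · refine ⟨.inr 1, .inr ?_⟩
        simp only [key, afterHi, Sum.elim_inl, Sum.elim_inr, Matrix.cons_val, lexTriple_lt_iff]
        omega
      · refine ⟨.inr 0, .inr ?_⟩
        simp only [key, afterLo, Sum.elim_inl, Sum.elim_inr, Matrix.cons_val, lexTriple_lt_iff]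
        omega
    · refine ⟨.inr 0, .inr ?_⟩
      simp only [key, afterLo, Sum.elim_inl, Sum.elim_inr, Matrix.cons_val, lexTriple_lt_iff]
      omega
  have hsep : ∀ v (e : G.edgeSet) w (f : G.edgeSet), v ∈ (e : Sym2 V) → w ∈ (f : Sym2 V) → v ≠ w → e ≠ f → Sep v e w f := by
    intro v e w f hv hw hvw hef
    rw [heq, Sym2.mem_iff] at hv hw
    rcases hv with rfl | rfl <;> rcases hw with rfl | rfl
    · have h4 : vid (lo e) ≠ vid (lo f) := fun h => hvw (hvid _ _ h)
      refine ⟨.inr 0, ?_⟩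
      simp only [key, afterLo, Sum.elim_inl, Sum.elim_inr, Matrix.cons_val, lexTriple_lt_iff]
      omega
    · exact hlohi_sep e f hef hvw
    · obtain ⟨i, hi | hi⟩ := hlohi_sep f e hef.symm hvw.symm
      · exact ⟨i, .inr hi⟩
      · exact ⟨i, .inl hi⟩
    · have h4 : vid (hi e) ≠ vid (hi f) := fun h => hvw (hvid _ _ h)
      refine ⟨.inr 1, ?_⟩
      simp only [key, afterHi, Sum.elim_inl, Sum.elim_inr, Matrix.cons_val, lexTriple_lt_iff]
      omega
  refine (hypergraphSeparationDimension_le_card _ key ?_).trans (by simp)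
  rintro _ ⟨x, hx, rfl⟩ _ ⟨y, hy, rfl⟩ hdisj
  obtain ⟨v, e, hv, rfl⟩ := exists_eq_of_mem_edgeSet_fullSubdivision hx
  obtain ⟨w, f, hw, rfl⟩ := exists_eq_of_mem_edgeSet_fullSubdivision hy
  rw [Set.disjoint_left] at hdisj
  have hvw : v ≠ w := by
    rintro rfl
    exact hdisj (a := Sum.inl v) (by simp) (by simp)
  have hef : e ≠ f := by
    rintro rfl
    exact hdisj (a := Sum.inr e) (by simp) (by simp)
  obtain ⟨i, hi⟩ := hsep v e w f hv hw hvw hef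
  refine ⟨i, ?_⟩
  simpa [and_assoc] using hi

/-- The same bound in terms of the chromatic number. -/
theorem separationDimension_fullSubdivision_le_of_colorable {V : Type*} [Finite V]
    (G : SimpleGraph V) {χ m : ℕ} (hG : G.Colorable χ) (hm : χ ≤ 2 ^ m.centralBinom) :
    separationDimension (fullSubdivision G) ≤ 2 * m + 4 := by
  obtain ⟨C⟩ := hG
  exact separationDimension_fullSubdivision_le G (fun v => (C v : ℕ))
    (fun u v h h' => C.valid h (Fin.ext h')) fun v => (C v).2.trans_le hm

/-! ### Asymptotic estimates -/

/-- Squaring the recursion for `centralBinom` reduces the induction to `4 * m * (m + 1) ≤ (2 * m +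
1) ^ 2`. -/
theorem sixteen_pow_le_centralBinom_sq {m : ℕ} (hm : 1 ≤ m) :
    16 ^ m ≤ 4 * m * m.centralBinom ^ 2 := by
  induction m, hm using Nat.le_induction with
  | base => simp [Nat.centralBinom]
  | succ m hm ih =>
    have hrec := Nat.succ_mul_centralBinom_succ m
    refine Nat.le_of_mul_le_mul_left (c := m + 1) ?_ (Nat.succ_pos m)
    calc (m + 1) * 16 ^ (m + 1) = 16 * (m + 1) * 16 ^ m := by ring
      _ ≤ 16 * (m + 1) * (4 * m * m.centralBinom ^ 2) := Nat.mul_le_mul_left _ ih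
      _ = 16 * (4 * m * (m + 1)) * m.centralBinom ^ 2 := by ring
      _ ≤ 16 * (2 * m + 1) ^ 2 * m.centralBinom ^ 2 := by
        gcongr
        nlinarith
      _ = 4 * (2 * (2 * m + 1) * m.centralBinom) ^ 2 := by ring
      _ = 4 * ((m + 1) * (m + 1).centralBinom) ^ 2 := by rw [hrec]
      _ = (m + 1) * (4 * (m + 1) * (m + 1).centralBinom ^ 2) := by ring

/-- A logarithmic form of the lower bound for the central binomial coefficient. -/
theorem le_logb_centralBinom {m : ℕ} (hm : 1 ≤ m) :
    2 * (m : ℝ) - 1 - Real.logb 2 m / 2 ≤ Real.logb 2 m.centralBinom := by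
  have hm0 : (0 : ℝ) < m := by exact_mod_cast hm
  have hc0 : (0 : ℝ) < m.centralBinom := by exact_mod_cast m.centralBinom_pos
  have h : (16 : ℝ) ^ m ≤ 4 * m * (m.centralBinom : ℝ) ^ 2 := by
    exact_mod_cast sixteen_pow_le_centralBinom_sq hm
  have h2 := Real.logb_le_logb_of_le (b := 2) one_lt_two (by positivity) h
  rw [Real.logb_mul (by positivity) (by positivity), Real.logb_mul (by norm_num) hm0.ne',
    Real.logb_pow, Real.logb_pow, show (16 : ℝ) = 2 ^ (4 : ℕ) by norm_num,
    show (4 : ℝ) = 2 ^ (2 : ℕ) by norm_num, Real.logb_pow, Real.logb_pow,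
    Real.logb_self_eq_one one_lt_two] at h2
  push_cast at h2
  linarith

theorem exists_le_two_pow_centralBinom {χ : ℕ}
    (hx : 16 ≤ Real.logb 2 (Real.logb 2 ((χ : ℝ) - 1))) :
    ∃ m : ℕ, χ ≤ 2 ^ m.centralBinom ∧
      2 * (m : ℝ) + 4 ≤ Real.logb 2 (Real.logb 2 ((χ : ℝ) - 1)) +
        Real.logb 2 (Real.logb 2 (Real.logb 2 ((χ : ℝ) - 1))) / 2 + 10 := by
  set X := Real.logb 2 ((χ : ℝ) - 1) with hX
  set x := Real.logb 2 X with hxdef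
  set y := Real.logb 2 x with hy
  have hχ2 : 2 ≤ χ := by
    -- For `χ ≤ 1` the conventions for `logb` at `0` and `-1` give `X = 0` and `x = 0`.
    by_contra! h
    interval_cases χ <;> norm_num at hX <;> rw [hxdef, hX] at hx <;> norm_num at hx
  have hχ : (1 : ℝ) ≤ (χ : ℝ) - 1 := by
    have : (2 : ℝ) ≤ χ := by exact_mod_cast hχ2
    linarith
  have hX0 : 0 ≤ X := Real.logb_nonneg one_lt_two hχ
  have hX1 : 1 ≤ X := by
    by_contra! h
    have := Real.logb_nonpos one_lt_two hX0 h.le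
    linarith
  have hx0 : 0 < x := by linarith
  have hy0 : 0 ≤ y := Real.logb_nonneg one_lt_two (by linarith)
  have hyx : y ≤ x := by
    rw [hy, Real.logb_le_iff_le_rpow one_lt_two hx0]
    have h := one_add_mul_self_le_rpow_one_add (s := 1) (by norm_num) (p := x) (by linarith)
    norm_num at h
    linarith
  -- The term `y / 4` offsets the loss `(log m) / 2 ≤ y / 2`; the `2` covers the constants,
  -- including `log χ ≤ X + 1 ≤ 2 * X`.
  refine ⟨⌈x / 2 + y / 4 + 2⌉₊, ?_, ?_⟩
  · set m := ⌈x / 2 + y / 4 + 2⌉₊ with hm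
    have hmx : x / 2 + y / 4 + 2 ≤ m := Nat.le_ceil _
    have hmlt : (m : ℝ) < x / 2 + y / 4 + 2 + 1 := Nat.ceil_lt_add_one (by positivity)
    have hm1 : 1 ≤ m := Nat.one_le_cast.mp (by linarith : (1 : ℝ) ≤ m)
    have hlogm : Real.logb 2 m ≤ y :=
      Real.logb_le_logb_of_le one_lt_two (by exact_mod_cast hm1) (by linarith)
    have hcb := le_logb_centralBinom hm1
    have hc0 : (0 : ℝ) < m.centralBinom := by exact_mod_cast m.centralBinom_pos
    have h2X : 2 * X ≤ m.centralBinom := by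
      rw [← Real.logb_le_logb one_lt_two (by linarith) hc0,
        Real.logb_mul two_ne_zero (by linarith), Real.logb_self_eq_one one_lt_two]
      linarith
    have hlogχ : Real.logb 2 χ ≤ m.centralBinom := by
      have h := Real.logb_le_logb_of_le (b := 2) one_lt_two (by linarith)
        (by linarith : (χ : ℝ) ≤ 2 * ((χ : ℝ) - 1))
      rw [Real.logb_mul two_ne_zero (by linarith), Real.logb_self_eq_one one_lt_two] at h
      linarith
    rw [Real.logb_le_iff_le_rpow one_lt_two (by linarith), Real.rpow_natCast] at hlogχ
    exact_mod_cast hlogχ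
  · have hmlt : (⌈x / 2 + y / 4 + 2⌉₊ : ℝ) < x / 2 + y / 4 + 2 + 1 :=
      Nat.ceil_lt_add_one (by positivity)
    linarith

theorem mainTheorem11 :
    ∃ ε : ℕ → ℝ, Filter.Tendsto ε Filter.atTop (nhds 0) ∧
      ∀ (V : Type u) [Finite V] (G : SimpleGraph V) (χ : ℕ),
        G.chromaticNumber = (χ : ℕ∞) → 6 ≤ χ →
          (separationDimension (fullSubdivision G) : ℝ) ≤
            Real.logb 2 (Real.logb 2 ((χ : ℝ) - 1)) +
              (1 / 2 + ε χ) * Real.logb 2 (Real.logb 2 (Real.logb 2 ((χ : ℝ) - 1))) + 2 := by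
  classical
  let x : ℕ → ℝ := fun χ => Real.logb 2 (Real.logb 2 ((χ : ℝ) - 1))
  -- Here `8 = 10 - 2` is the excess constant for large `χ`; the other branch, the crude bound with
  -- `m = χ`, does not affect the limit.
  let ε : ℕ → ℝ := fun χ => (if 16 ≤ x χ then 8 else 2 * (χ : ℝ) + 4) / Real.logb 2 (x χ)
  have hx : Filter.Tendsto x Filter.atTop Filter.atTop :=
    (Real.tendsto_logb_atTop one_lt_two).comp ((Real.tendsto_logb_atTop one_lt_two).comp
      (Filter.tendsto_atTop_add_const_right _ (-1) tendsto_natCast_atTop_atTop))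
  refine ⟨ε, ?_, ?_⟩
  · have h : Filter.Tendsto (fun χ => 8 / Real.logb 2 (x χ)) Filter.atTop (nhds 0) :=
      ((Real.tendsto_logb_atTop one_lt_two).comp hx).const_div_atTop 8
    refine h.congr' ?_
    filter_upwards [hx.eventually_ge_atTop 16] with χ hχ
    simp only [ε, if_pos hχ]
  · intro V _ G χ hG hχ
    have hcol : G.Colorable χ := SimpleGraph.chromaticNumber_le_iff_colorable.mp hG.le
    have hχ6 : (6 : ℝ) ≤ χ := by exact_mod_cast hχ
    have hX : 2 < Real.logb 2 ((χ : ℝ) - 1) := by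
      rw [Real.lt_logb_iff_rpow_lt one_lt_two (by linarith)]
      norm_num
      linarith
    have hx1 : 1 < x χ := by
      rw [Real.lt_logb_iff_rpow_lt one_lt_two (by linarith)]
      simpa using hX
    have hy : 0 < Real.logb 2 (x χ) := Real.logb_pos one_lt_two hx1
    change _ ≤ x χ + (1 / 2 + ε χ) * Real.logb 2 (x χ) + 2
    rw [add_mul, div_mul_cancel₀ _ hy.ne']
    split_ifs with hlarge
    · obtain ⟨m, hm, hbound⟩ := exists_le_two_pow_centralBinom hlarge
      have h : (separationDimension (fullSubdivision G) : ℝ) ≤ 2 * m + 4 := by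
        exact_mod_cast separationDimension_fullSubdivision_le_of_colorable G hcol hm
      change _ ≤ x χ + Real.logb 2 (x χ) / 2 + 10 at hbound
      linarith
    · have hm : χ ≤ 2 ^ χ.centralBinom :=
        Nat.lt_two_pow_self.le.trans (Nat.pow_le_pow_right two_pos
          Nat.centralBinom_strictMono.le_apply)
      have h : (separationDimension (fullSubdivision G) : ℝ) ≤ 2 * χ + 4 := by
        exact_mod_cast separationDimension_fullSubdivision_le_of_colorable G hcol hm
      linarith
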